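/- Let $K$ be a field, let $n_1<n_2<n_3<n_4$ be positive integers with $\gcd(n_1,n_2,n_3,n_4)=1$, and let $C$ be the monomial curve $x_i=t^{n_i}$ $(1\le i\le 4)$ in $\mathbb{A}^4(K)$, with toric ideal $I(C)=\ker\bigl(K[x_1,x_2,x_3,x_4]\to K[t],\ x_i\mapsto t^{n_i}\bigr)$. Suppose that $I(C)$ is minimally generated by the five binomials $$f_1=x_1^{a_1}-x_2^{a_{12}}x_3^{a_{13}},\quad f_2=x_2^{a_2}-x_3^{a_{23}}x_4^{a_{24}},\quad f_3=x_3^{a_3}-x_1^{a_{31}}x_4^{a_{34}},$$ $$f_4=x_4^{a_4}-x_1^{a_{41}}x_2^{a_{42}},\quad f_5=x_1^{a_{41}}x_3^{a_{23}}-x_2^{a_{12}}x_4^{a_{34}},$$ where $0<a_{ij}<a_j$ for all the exponents $a_{ij}$ that occur (case 2(a) of Bresinsky's form of the defining ideal of a non-complete-intersection Gorenstein monomial curve), and that $a_{34}\le a_{24}$. Let $I(C)_*$ be the ideal generated by the homogeneous summands of least degree of the elements of $I(C)$. Then the tangent cone of $C$ at the origin is Cohen–Macaulay, i.e. $K[x_1,x_2,x_3,x_4]/I(C)_*$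 is a Cohen–Macaulay ring, if and only if the following three conditions hold: 1. $a_3\le a_{31}+a_{34}$; 2. $a_{12}+a_{34}\le a_{41}+a_{23}$; 3. either $a_{23}<a_{13}$ and $a_2+a_{12}\le a_{41}+2a_{23}+a_{24}-a_{34}$, or $a_{13}\le a_{23}$ and $a_2+a_{12}\le a_1+a_{23}-a_{13}+a_{24}$. -/

import Mathlib

open MvPolynomial

noncomputable section

/-- The toric ideal `I(C)` of the affine monomial curve `x i = t ^ n i`: the kernel of the
`K`-algebra homomorphism `K[x] → K[t]`, `x i ↦ t ^ n i`. -/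
def toricIdeal (K : Type*) [Field K] {d : ℕ} (n : Fin d → ℕ) : Ideal (MvPolynomial (Fin d) K) :=
  RingHom.ker (aeval (fun i => (Polynomial.X : Polynomial K) ^ n i) :
    MvPolynomial (Fin d) K →ₐ[K] Polynomial K)

/-- The homogeneous summand of least degree of a polynomial `f` (it is `0` for `f = 0`). -/
def initialForm {K : Type*} [Field K] {d : ℕ} (f : MvPolynomial (Fin d) K) :
    MvPolynomial (Fin d) K :=
  homogeneousComponent (sInf {e : ℕ | homogeneousComponent e f ≠ 0}) f

/-- The ideal generated by the homogeneous summands of least degree of all elements of `I`. -/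
def tangentConeIdeal {K : Type*} [Field K] {d : ℕ} (I : Ideal (MvPolynomial (Fin d) K)) :
    Ideal (MvPolynomial (Fin d) K) :=
  Ideal.span (initialForm '' (I : Set (MvPolynomial (Fin d) K)))

/-- The coordinate ring of the tangent cone at the origin of the monomial curve `x i = t ^ n i`. -/
abbrev TangentCone (K : Type*) [Field K] {d : ℕ} (n : Fin d → ℕ) : Type _ :=
  MvPolynomial (Fin d) K ⧸ tangentConeIdeal (toricIdeal K n)

/-- The depth of a local ring: the supremum of the lengths of the regular sequences contained in
its maximal ideal. -/
def localDepth (R : Type*) [CommRing R] [IsLocalRing R] : ℕ∞ :=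
  ⨆ rs : {rs : List R // (∀ r ∈ rs, r ∈ IsLocalRing.maximalIdeal R) ∧
    RingTheory.Sequence.IsRegular R rs}, (rs.1.length : ℕ∞)

/-- A commutative ring is Cohen-Macaulay if it is Noetherian and each localization at a maximal
ideal has depth equal to its Krull dimension. -/
def IsCohenMacaulayRing (R : Type*) [CommRing R] : Prop :=
  IsNoetherianRing R ∧ ∀ (m : Ideal R) [m.IsMaximal],
    ((localDepth (Localization.AtPrime m) : ℕ∞) : WithBot ℕ∞) =
      ringKrullDim (Localization.AtPrime m)

/-- `G` generates the ideal `I` and no proper subset of `G` does. -/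
def IsMinimalGeneratingSet {R : Type*} [CommRing R] (G : Set R) (I : Ideal R) : Prop :=
  Ideal.span G = I ∧ ∀ G' : Set R, G' ⊂ G → Ideal.span G' ≠ I

/-- `I(C)` is given as in case 2(a): it is minimally generated by the five binomials
`f₁ = (1,(2,3))`, `f₂ = (2,(3,4))`, `f₃ = (3,(1,4))`, `f₄ = (4,(1,2))`, `f₅ = ((2,4),(1,3))`
with `0 < a_ij < a_j`. The variables `x₁, x₂, x₃, x₄` are `X 0, X 1, X 2, X 3`. -/
structure IsGorensteinCase2a (K : Type*) [Field K] (n : Fin 4 → ℕ)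
    (a₁ a₂ a₃ a₄ a₁₂ a₁₃ a₂₃ a₂₄ a₃₁ a₃₄ a₄₁ a₄₂ : ℕ) : Prop where
  bound₁₂ : 0 < a₁₂ ∧ a₁₂ < a₂
  bound₁₃ : 0 < a₁₃ ∧ a₁₃ < a₃
  bound₂₃ : 0 < a₂₃ ∧ a₂₃ < a₃
  bound₂₄ : 0 < a₂₄ ∧ a₂₄ < a₄
  bound₃₁ : 0 < a₃₁ ∧ a₃₁ < a₁
  bound₃₄ : 0 < a₃₄ ∧ a₃₄ < a₄
  bound₄₁ : 0 < a₄₁ ∧ a₄₁ < a₁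
  bound₄₂ : 0 < a₄₂ ∧ a₄₂ < a₂
  generators : IsMinimalGeneratingSet
    ({X 0 ^ a₁ - X 1 ^ a₁₂ * X 2 ^ a₁₃,
      X 1 ^ a₂ - X 2 ^ a₂₃ * X 3 ^ a₂₄,
      X 2 ^ a₃ - X 0 ^ a₃₁ * X 3 ^ a₃₄,
      X 3 ^ a₄ - X 0 ^ a₄₁ * X 1 ^ a₄₂,
      X 0 ^ a₄₁ * X 2 ^ a₂₃ - X 1 ^ a₁₂ * X 3 ^ a₃₄} : Set (MvPolynomial (Fin 4) K))
    (toricIdeal K n)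

end

/-! The tangent cone has a basis indexed by the semigroup generated by the `n i`. In each weight the
monomials of largest degree become equal modulo $I(C)_*$, and all the others vanish, because the
initial form of $x^e-x^g$ with $\deg e<\deg g$ is $x^e$. `mem_tangentConeIdeal_iff` makes this
precise.

The variables $x_2,x_3,x_4$ are nilpotent in the tangent cone, since $x_j^{n_1}$ and $x_1^{n_j}$
have the same weight. So the ring has dimension one, and it is Cohen–Macaulay iff $x_1$ is a
nonzerodivisor, that is, iff multiplication by $x_1$ preserves maximality of degree
(`isCohenMacaulayRing_tangentCone_iff`). Equivalently, every monomial with the weight of some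
multiple of $x_1$ is matched by a multiple of $x_1$ of the same weight and at least the same degree
(`HasMultipleOfX₁`).

Necessity: the weight classes of $x_3^{a_3}$, $x_2^{a_{12}}x_4^{a_{34}}$ and $x_2^{a_2+a_{12}}$ are
computed completely. Comparing degrees within them gives the three conditions. A set of monomials is
a union of weight classes as soon as it is stable under the five generating binomials
(`of_isMoveInvariant`).

Sufficiency: six substitutions, none of which lowers the degree, rewrite a monomial free of $x_1$
until $x_1$ appears. A monomial to which none applies shares its weight with no multiple of $x_1$
(`eq_zero_of_weight_eq`). -/

/-! ### The tangent cone ideal as the kernel of a linear map -/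

section OrderSymbol

/-- `e` has the largest degree among the exponents of the same weight. -/
def IsMaxDeg {d : ℕ} (n : Fin d → ℕ) (e : Fin d →₀ ℕ) : Prop :=
  ∀ g, Finsupp.weight n g = Finsupp.weight n e → g.degree ≤ e.degree

theorem IsMaxDeg.of_le {d : ℕ} {n : Fin d → ℕ} {e u : Fin d →₀ ℕ} (h : IsMaxDeg n (e + u)) :
    IsMaxDeg n e := by
  intro g hg
  have := h (g + u) (by simp [hg])
  simpa using this

theorem IsMaxDeg.congr {d : ℕ} {n : Fin d → ℕ} {e g : Fin d →₀ ℕ} (h : IsMaxDeg n e)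
    (hw : Finsupp.weight n e = Finsupp.weight n g) (hd : e.degree ≤ g.degree) : IsMaxDeg n g :=
  fun k hk => (h k (hk.trans hw.symm)).trans hd

theorem degree_le_weight {d : ℕ} {n : Fin d → ℕ} (hpos : ∀ i, 0 < n i) (e : Fin d →₀ ℕ) :
    e.degree ≤ Finsupp.weight n e := by
  rw [Finsupp.weight_eq_sum, Finsupp.degree_eq_sum]
  exact Finset.sum_le_sum fun i _ => by simpa using Nat.le_mul_of_pos_right _ (hpos i)

theorem exists_isMaxDeg {d : ℕ} {n : Fin d → ℕ} (hpos : ∀ i, 0 < n i) (e : Fin d →₀ ℕ) :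
    ∃ g, Finsupp.weight n g = Finsupp.weight n e ∧ IsMaxDeg n g := by
  let S : Set ℕ := {k | ∃ g : Fin d →₀ ℕ,
    Finsupp.weight n g = Finsupp.weight n e ∧ g.degree = k}
  have hbd : BddAbove S := by
    refine ⟨Finsupp.weight n e, ?_⟩
    rintro k ⟨g, hg, rfl⟩
    exact hg ▸ degree_le_weight hpos g
  obtain ⟨g, hg, hgd⟩ := Nat.sSup_mem (s := S) ⟨e.degree, e, rfl, rfl⟩ hbd
  refine ⟨g, hg, fun k hk => ?_⟩
  rw [hgd]
  exact le_csSup hbd ⟨k, hk.trans hg, rfl⟩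

open Classical in
/-- The linear map `K[x] → K[t]` sending a monomial of the largest degree among those of its
weight to the corresponding power of `t`, and all other monomials to `0`. -/
noncomputable def orderSymbol (K : Type*) [Field K] {d : ℕ} (n : Fin d → ℕ) :
    MvPolynomial (Fin d) K →ₗ[K] Polynomial K :=
  (basisMonomials (Fin d) K).constr K
    (fun e => if IsMaxDeg n e then (Polynomial.X : Polynomial K) ^ Finsupp.weight n e else 0)

variable {K : Type*} [Field K] {d : ℕ} {n : Fin d → ℕ}

open Classical in
theorem orderSymbol_monomial (e : Fin d →₀ ℕ) (c : K) :
    orderSymbol K n (monomial e c) =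
      if IsMaxDeg n e then Polynomial.monomial (Finsupp.weight n e) c else 0 := by
  have h1 : orderSymbol K n (monomial e 1) =
      if IsMaxDeg n e then (Polynomial.X : Polynomial K) ^ Finsupp.weight n e else 0 := by
    have := (basisMonomials (Fin d) K).constr_basis K
      (fun e => if IsMaxDeg n e then (Polynomial.X : Polynomial K) ^ Finsupp.weight n e else 0) e
    rwa [coe_basisMonomials] at this
  have : (monomial e c : MvPolynomial (Fin d) K) = c • monomial e 1 := by
    simp [smul_monomial]
  rw [this, map_smul, h1]
  split_ifs
  · rw [← Polynomial.monomial_one_right_eq_X_pow, Polynomial.smul_monomial, smul_eq_mul, mul_one]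
  · simp

theorem orderSymbol_monomial_of_isMaxDeg {e : Fin d →₀ ℕ} (he : IsMaxDeg n e) (c : K) :
    orderSymbol K n (monomial e c) = Polynomial.monomial (Finsupp.weight n e) c := by
  rw [orderSymbol_monomial, if_pos he]

theorem orderSymbol_monomial_of_not_isMaxDeg {e : Fin d →₀ ℕ} (he : ¬ IsMaxDeg n e) (c : K) :
    orderSymbol K n (monomial e c) = 0 := by
  rw [orderSymbol_monomial, if_neg he]

/-- The kernel is an ideal. Multiplying by $x^u$ either kills a whole weight or preserves which
monomials of that weight are maximal: if $u+e_0$ is maximal and $e$ has the weight of $e_0$, then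
$u+e$ is maximal iff $e$ is. So each coefficient of the new symbol is zero or a multiple of an old
one. -/
theorem orderSymbol_mul_eq_zero (p : MvPolynomial (Fin d) K) {f : MvPolynomial (Fin d) K}
    (hf : orderSymbol K n f = 0) : orderSymbol K n (p * f) = 0 := by
  classical
  induction p using MvPolynomial.induction_on' with
  | add p q hp hq => rw [add_mul, map_add, hp, hq, add_zero]
  | monomial u c =>
    ext s
    by_cases hs : ∃ e₀, IsMaxDeg n (u + e₀) ∧ Finsupp.weight n (u + e₀) = s
    · obtain ⟨e₀, he₀, hs⟩ := hs
      have : (Polynomial.lcoeff K s) ∘ₗ (orderSymbol K n) ∘ₗ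
          (LinearMap.mulLeft K (monomial u c : MvPolynomial (Fin d) K)) =
          c • ((Polynomial.lcoeff K (Finsupp.weight n e₀)) ∘ₗ (orderSymbol K n)) := by
        refine (basisMonomials (Fin d) K).ext fun e => ?_
        simp only [coe_basisMonomials, LinearMap.comp_apply, LinearMap.mulLeft_apply,
          LinearMap.smul_apply, monomial_mul, mul_one, Polynomial.lcoeff_apply, orderSymbol_monomial]
        by_cases hw : Finsupp.weight n e = Finsupp.weight n e₀
        · have hiff : IsMaxDeg n (u + e) ↔ IsMaxDeg n e := by
            constructor
            · intro h; rw [add_comm] at h; exact h.of_le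
            · intro h
              refine he₀.congr (by simp [hw]) ?_
              have := h e₀ hw.symm
              simpa using this
          rw [hiff]
          split_ifs <;> simp [← hs, hw]
        · split_ifs <;> simp [← hs, Polynomial.coeff_monomial, hw]
      have h := LinearMap.congr_fun this f
      simpa [hf] using h
    · push Not at hs
      have : (Polynomial.lcoeff K s) ∘ₗ (orderSymbol K n) ∘ₗ
          (LinearMap.mulLeft K (monomial u c : MvPolynomial (Fin d) K)) = 0 := by
        refine (basisMonomials (Fin d) K).ext fun e => ?_
        simp only [coe_basisMonomials, LinearMap.comp_apply, LinearMap.mulLeft_apply,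
          LinearMap.zero_apply, monomial_mul, mul_one, Polynomial.lcoeff_apply, orderSymbol_monomial]
        split_ifs with h
        · rw [Polynomial.coeff_monomial, if_neg (hs e h)]
        · simp
      simpa using LinearMap.congr_fun this f

theorem aeval_X_pow_monomial (e : Fin d →₀ ℕ) (c : K) :
    aeval (fun i => (Polynomial.X : Polynomial K) ^ n i) (monomial e c) =
      Polynomial.monomial (Finsupp.weight n e) c := by
  rw [aeval_monomial, ← Polynomial.C_mul_X_pow_eq_monomial, Finsupp.weight_eq_sum,
    Finsupp.prod_fintype _ _ (by simp)]
  simp [← pow_mul, mul_comm, Finset.prod_pow_eq_pow_sum]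

theorem monomial_sub_monomial_mem_toricIdeal {e g : Fin d →₀ ℕ} :
    (monomial e 1 - monomial g 1 : MvPolynomial (Fin d) K) ∈ toricIdeal K n ↔
      Finsupp.weight n e = Finsupp.weight n g := by
  rw [toricIdeal, RingHom.mem_ker, map_sub]
  erw [aeval_X_pow_monomial, aeval_X_pow_monomial]
  rw [sub_eq_zero, Polynomial.monomial_left_inj one_ne_zero]

theorem orderSymbol_initialForm {f : MvPolynomial (Fin d) K} (hf : f ∈ toricIdeal K n) :
    orderSymbol K n (initialForm f) = 0 := by
  classical
  ext s
  set D := sInf {e : ℕ | homogeneousComponent e f ≠ 0} with hD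
  have hlow : ∀ e ∈ f.support, D ≤ e.degree := by
    intro e he
    refine Nat.sInf_le fun h0 => ?_
    have := congrArg (coeff e) h0
    rw [coeff_homogeneousComponent, if_pos rfl] at this
    simp_all
  have hker : (aeval (fun i => (Polynomial.X : Polynomial K) ^ n i) :
    MvPolynomial (Fin d) K →ₐ[K] Polynomial K) f = 0 := hf
  have hzero : ∑ e ∈ f.support, (if Finsupp.weight n e = s then coeff e f else 0) = 0 := by
    have := congrArg (fun p => Polynomial.coeff p s) hker
    simp only [Polynomial.coeff_zero] at this
    rw [f.as_sum, map_sum, Polynomial.finsetSum_coeff] at this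
    simpa only [aeval_X_pow_monomial, Polynomial.coeff_monomial] using this
  have hform : (orderSymbol K n (initialForm f)).coeff s = ∑ e ∈ f.support,
      if e.degree = D ∧ IsMaxDeg n e ∧ Finsupp.weight n e = s then coeff e f else 0 := by
    rw [initialForm, homogeneousComponent_apply, map_sum, Polynomial.finsetSum_coeff,
      Finset.sum_filter]
    refine Finset.sum_congr rfl fun e _ => ?_
    rw [orderSymbol_monomial]
    split_ifs <;> simp_all [Polynomial.coeff_monomial]
  rw [hform, Polynomial.coeff_zero]
  -- If the largest degree in weight $s$ is the order $D$ of $f$, every monomial of $f$ of weight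
  -- $s$ has degree exactly $D$, and their coefficients sum to zero because $f$ is in the toric
  -- ideal. Otherwise the sum has no nonzero term.
  by_cases hs : ∃ e₀, e₀.degree = D ∧ IsMaxDeg n e₀ ∧ Finsupp.weight n e₀ = s
  · obtain ⟨e₀, h1, h2, h3⟩ := hs
    refine Eq.trans ?_ hzero
    refine Finset.sum_congr rfl fun e he => if_congr ⟨fun h => h.2.2, fun h => ?_⟩ rfl rfl
    have hle := h2 e (h.trans h3.symm)
    have hge := hlow e he
    exact ⟨by omega, h2.congr (h3.trans h.symm) (by omega), h⟩
  · push Not at hs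
    exact Finset.sum_eq_zero fun e _ => if_neg fun h => hs e h.1 h.2.1 h.2.2

theorem initialForm_eq_of_homogeneousComponent {f : MvPolynomial (Fin d) K} {k : ℕ}
    (hlt : ∀ j < k, homogeneousComponent j f = 0) (hk : homogeneousComponent k f ≠ 0) :
    initialForm f = homogeneousComponent k f := by
  have : sInf {e : ℕ | homogeneousComponent e f ≠ 0} = k := by
    refine le_antisymm (Nat.sInf_le hk) (le_csInf ⟨k, hk⟩ fun j hj => ?_)
    by_contra! h
    exact hj (hlt j h)
  rw [initialForm, this]

theorem monomial_mem_tangentConeIdeal {e g : Fin d →₀ ℕ} (hg : e.degree < g.degree)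
    (hw : Finsupp.weight n g = Finsupp.weight n e) :
    (monomial e 1 : MvPolynomial (Fin d) K) ∈ tangentConeIdeal (toricIdeal K n) := by
  have hcomp : ∀ j ≤ e.degree, homogeneousComponent j
      (monomial e 1 - monomial g 1 : MvPolynomial (Fin d) K) =
        if j = e.degree then monomial e 1 else 0 := by
    intro j hj
    rw [map_sub, homogeneousComponent_of_mem (isHomogeneous_monomial 1 rfl),
      homogeneousComponent_of_mem (isHomogeneous_monomial 1 rfl),
      if_neg (by omega : j ≠ g.degree), sub_zero]
  refine Ideal.subset_span
    ⟨_, (monomial_sub_monomial_mem_toricIdeal (K := K)).2 hw.symm, ?_⟩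
  rw [initialForm_eq_of_homogeneousComponent (k := e.degree), hcomp _ le_rfl, if_pos rfl]
  · intro j hj
    rw [hcomp j hj.le, if_neg hj.ne]
  · rw [hcomp _ le_rfl, if_pos rfl]
    simp

theorem monomial_sub_mem_tangentConeIdeal {e g : Fin d →₀ ℕ} (hg : e.degree = g.degree)
    (hw : Finsupp.weight n g = Finsupp.weight n e) :
    (monomial e 1 - monomial g 1 : MvPolynomial (Fin d) K) ∈
      tangentConeIdeal (toricIdeal K n) := by
  by_cases heg : e = g
  · simp [heg]
  have hne : (monomial e 1 - monomial g 1 : MvPolynomial (Fin d) K) ≠ 0 := by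
    rw [sub_ne_zero]
    intro h
    exact heg (by simpa using (monomial_left_inj one_ne_zero).1 h)
  have hcomp : ∀ j, homogeneousComponent j
      (monomial e 1 - monomial g 1 : MvPolynomial (Fin d) K) =
        if j = e.degree then monomial e 1 - monomial g 1 else 0 := by
    intro j
    rw [map_sub, homogeneousComponent_of_mem (isHomogeneous_monomial 1 rfl),
      homogeneousComponent_of_mem (isHomogeneous_monomial 1 rfl), hg]
    split_ifs <;> simp
  refine Ideal.subset_span
    ⟨_, (monomial_sub_monomial_mem_toricIdeal (K := K)).2 hw.symm, ?_⟩
  rw [initialForm_eq_of_homogeneousComponent (k := e.degree), hcomp, if_pos rfl]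
  · intro j hj
    rw [hcomp j, if_neg hj.ne]
  · rwa [hcomp, if_pos rfl]

theorem mem_tangentConeIdeal_iff (hpos : ∀ i, 0 < n i) {f : MvPolynomial (Fin d) K} :
    f ∈ tangentConeIdeal (toricIdeal K n) ↔ orderSymbol K n f = 0 := by
  classical
  constructor
  · intro hf
    induction hf using Submodule.span_induction with
    | mem x hx =>
      obtain ⟨g, hg, rfl⟩ := hx
      exact orderSymbol_initialForm hg
    | zero => simp
    | add x y _ _ hx hy => rw [map_add, hx, hy, add_zero]
    | smul a x _ hx => exact orderSymbol_mul_eq_zero a hx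
  · intro hf
    have hmax : ∀ s, (∃ e : Fin d →₀ ℕ, Finsupp.weight n e = s) →
        ∃ g, Finsupp.weight n g = s ∧ IsMaxDeg n g := by
      rintro s ⟨e, rfl⟩
      exact exists_isMaxDeg hpos e
    choose! τ hτ using hmax
    let lift : Polynomial K →ₗ[K] MvPolynomial (Fin d) K :=
      (Polynomial.basisMonomials K).constr K (fun s => (monomial (τ s) 1 : MvPolynomial (Fin d) K))
    have hlift : ∀ s, lift (Polynomial.monomial s 1) = monomial (τ s) 1 := by
      intro s
      have := (Polynomial.basisMonomials K).constr_basis K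
        (fun s => (monomial (τ s) 1 : MvPolynomial (Fin d) K)) s
      rwa [Polynomial.coe_basisMonomials] at this
    -- `τ` picks one maximal monomial per weight. Modulo the ideal every polynomial is a combination
    -- of these representatives, with coefficients read off from its symbol.
    have key : ∀ g : MvPolynomial (Fin d) K,
        g - lift (orderSymbol K n g) ∈ tangentConeIdeal (toricIdeal K n) := by
      intro g
      induction g using MvPolynomial.induction_on' with
      | add p q hp hq =>
        rw [map_add, map_add, add_sub_add_comm]
        exact Ideal.add_mem _ hp hq
      | monomial e c =>
        have hc : (monomial e c : MvPolynomial (Fin d) K) = c • monomial e 1 := by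
          simp [smul_monomial]
        rw [hc, map_smul, map_smul, ← smul_sub, MvPolynomial.smul_eq_C_mul]
        refine Ideal.mul_mem_left _ _ ?_
        obtain ⟨h1, h2⟩ := hτ _ ⟨e, rfl⟩
        by_cases he : IsMaxDeg n e
        · rw [orderSymbol_monomial_of_isMaxDeg he, hlift]
          exact monomial_sub_mem_tangentConeIdeal
            (le_antisymm (h2 _ h1.symm) (he _ h1)) h1
        · rw [orderSymbol_monomial_of_not_isMaxDeg he, map_zero, sub_zero]
          simp only [IsMaxDeg, not_forall, not_le] at he
          obtain ⟨g, hg, hlt⟩ := he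
          exact monomial_mem_tangentConeIdeal hlt hg
    simpa [hf] using key f

end OrderSymbol

/-! ### Depth of local rings -/

section LocalDepth

variable {R : Type*} [CommRing R] [IsLocalRing R]

theorem localDepth_le_ringKrullDim [IsNoetherianRing R] :
    ((localDepth R : ℕ∞) : WithBot ℕ∞) ≤ ringKrullDim R := by
  obtain ⟨k, hk⟩ : ∃ k : ℕ∞, ringKrullDim R = k :=
    ⟨(ringKrullDim R).unbot (ringKrullDim_ne_bot (R := R)), (WithBot.coe_unbot _ _).symm⟩
  rw [hk, WithBot.coe_le_coe]
  refine iSup_le fun rs => ?_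
  rw [← WithBot.coe_le_coe, ← hk,
    ← ringKrullDim_add_length_eq_ringKrullDim_of_isRegular rs.1 rs.2.2]
  have : Nontrivial (R ⧸ Ideal.ofList rs.1) := by
    rw [Ideal.Quotient.nontrivial_iff]
    have := rs.2.2.top_ne_smul
    simpa [eq_comm] using this
  exact le_add_of_nonneg_left (ringKrullDim_nonneg_of_nontrivial (R := R ⧸ Ideal.ofList rs.1))

theorem one_le_localDepth {r : R} (hr : r ∈ IsLocalRing.maximalIdeal R)
    (hreg : r ∈ nonZeroDivisors R) : 1 ≤ localDepth R := by
  have h : RingTheory.Sequence.IsRegular R [r] := by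
    refine RingTheory.Sequence.IsRegular.of_isWeaklyRegular_of_mem_maximalIdeal R
      (by simpa using hr) ?_
    exact (RingTheory.Sequence.isWeaklyRegular_singleton_iff R r).2
      (Module.Flat.isSMulRegular_of_nonZeroDivisors hreg)
  exact le_iSup (fun rs : {rs : List R // (∀ r ∈ rs, r ∈ IsLocalRing.maximalIdeal R) ∧
    RingTheory.Sequence.IsRegular R rs} => (rs.1.length : ℕ∞)) ⟨[r], by simpa using hr, h⟩

theorem localDepth_eq_zero {z : R} (hz : z ≠ 0)
    (h : ∀ r ∈ IsLocalRing.maximalIdeal R, r * z = 0) : localDepth R = 0 := by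
  refine le_antisymm (iSup_le ?_) bot_le
  rintro ⟨rs, hrs, hreg⟩
  cases rs with
  | nil => simp
  | cons r rs =>
    have h1 := ((RingTheory.Sequence.isRegular_cons_iff R r rs).1 hreg).1
    refine absurd (h1 ?_) hz
    simpa using h r (hrs r (by simp))

end LocalDepth

/-! ### Algebras in which all variables but one are nilpotent -/

section AxisAlgebra

/-- The projection of `K[x]` onto the polynomial ring in the variable `x i₀`. -/
noncomputable def axisProj (K : Type*) [Field K] {d : ℕ} (i₀ : Fin d) :
    MvPolynomial (Fin d) K →ₐ[K] Polynomial K :=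
  aeval (fun i => if i = i₀ then Polynomial.X else 0)

variable {K : Type*} [Field K] {d : ℕ}

theorem aeval_surjective_of_map_X_eq_zero {B : Type*} [CommRing B] [Algebra K B] (i₀ : Fin d)
    (φ : MvPolynomial (Fin d) K →ₐ[K] B) (hφ : Function.Surjective φ)
    (h : ∀ j, j ≠ i₀ → φ (X j) = 0) : Function.Surjective (Polynomial.aeval (R := K) (φ (X i₀))) := by
  have : φ = (Polynomial.aeval (φ (X i₀))).comp (axisProj K i₀) := by
    refine MvPolynomial.algHom_ext fun j => ?_
    by_cases hj : j = i₀
    · simp [axisProj, hj]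
    · simp [axisProj, hj, h j hj]
  intro b
  obtain ⟨a, rfl⟩ := hφ b
  exact ⟨axisProj K i₀ a, (DFunLike.congr_fun this a).symm⟩

theorem ringKrullDim_quotient_nilradical (R : Type*) [CommRing R] :
    ringKrullDim (R ⧸ nilradical R) = ringKrullDim R := by
  rw [ringKrullDim_quotient]
  have : PrimeSpectrum.zeroLocus (nilradical R : Set R) = Set.univ := by
    ext p
    simp
  rw [this]
  exact Order.krullDim_eq_of_orderIso OrderIso.Set.univ

variable {R : Type*} [CommRing R] [Algebra K R] {φ : MvPolynomial (Fin d) K →ₐ[K] R} {i₀ : Fin d}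

theorem aeval_quotient_surjective (hφ : Function.Surjective φ)
    (hnil : ∀ j, j ≠ i₀ → IsNilpotent (φ (X j))) (I : Ideal R) (hI : nilradical R ≤ I) :
    Function.Surjective (Polynomial.aeval (R := K) (Ideal.Quotient.mkₐ K I (φ (X i₀)))) :=
  aeval_surjective_of_map_X_eq_zero i₀ ((Ideal.Quotient.mkₐ K I).comp φ)
    ((Ideal.Quotient.mkₐ_surjective K I).comp hφ)
    fun j hj => Ideal.Quotient.eq_zero_iff_mem.2 (hI (mem_nilradical.2 (hnil j hj)))

theorem ringKrullDim_le_one_of_isNilpotent (hφ : Function.Surjective φ)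
    (hnil : ∀ j, j ≠ i₀ → IsNilpotent (φ (X j))) : ringKrullDim R ≤ 1 := by
  rw [← ringKrullDim_quotient_nilradical,
    ← IsPrincipalIdealRing.ringKrullDim_eq_one (Polynomial K) (Polynomial.not_isField K)]
  exact ringKrullDim_le_of_surjective
    (Polynomial.aeval (R := K) (Ideal.Quotient.mkₐ K (nilradical R) (φ (X i₀)))).toRingHom
    (aeval_quotient_surjective hφ hnil _ le_rfl)

theorem exists_aeval_mem_of_isMaximal (hφ : Function.Surjective φ)
    (hnil : ∀ j, j ≠ i₀ → IsNilpotent (φ (X j))) (m : Ideal R) [m.IsMaximal] :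
    ∃ p : Polynomial K, p ≠ 0 ∧ Polynomial.aeval (φ (X i₀)) p ∈ m := by
  by_contra! h
  have hs := aeval_quotient_surjective hφ hnil m
    (nilradical_le_prime m)
  have hi : Function.Injective
      (Polynomial.aeval (R := K) (Ideal.Quotient.mkₐ K m (φ (X i₀)))) := by
    rw [injective_iff_map_eq_zero]
    intro p hp
    by_contra hp0
    rw [Polynomial.aeval_algHom_apply] at hp
    exact h p hp0 (Ideal.Quotient.eq_zero_iff_mem.1 hp)
  have hf : IsField (R ⧸ m) := (Ideal.Quotient.maximal_ideal_iff_isField_quotient m).1 ‹_›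
  exact Polynomial.not_isField K
    ((RingEquiv.ofBijective _ ⟨hi, hs⟩).toMulEquiv.isField hf)

/-- Modulo its nilradical the ring is a quotient of $K[x_{i_0}]$, so its dimension is at most one.
Each maximal ideal contains some nonzero polynomial in $x_{i_0}$, whose regularity gives depth at
least one there. -/
theorem isCohenMacaulayRing_of_aeval_mem_nonZeroDivisors (hφ : Function.Surjective φ)
    (hnil : ∀ j, j ≠ i₀ → IsNilpotent (φ (X j)))
    (hreg : ∀ p : Polynomial K, p ≠ 0 → Polynomial.aeval (φ (X i₀)) p ∈ nonZeroDivisors R) :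
    IsCohenMacaulayRing R := by
  have hN : IsNoetherianRing R := isNoetherianRing_of_surjective _ R φ.toRingHom hφ
  refine ⟨hN, fun m hm => ?_⟩
  have : IsNoetherianRing (Localization.AtPrime m) :=
    IsLocalization.isNoetherianRing m.primeCompl _ hN
  refine le_antisymm localDepth_le_ringKrullDim ?_
  have hdim : ringKrullDim (Localization.AtPrime m) ≤ 1 := by
    rw [IsLocalization.AtPrime.ringKrullDim_eq_height m]
    exact Ideal.height_le_ringKrullDim_of_isPrime.trans
      (ringKrullDim_le_one_of_isNilpotent hφ hnil)
  obtain ⟨p, hp0, hpm⟩ := exists_aeval_mem_of_isMaximal hφ hnil m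
  have hmem : algebraMap R (Localization.AtPrime m) (Polynomial.aeval (φ (X i₀)) p) ∈
      nonZeroDivisors (Localization.AtPrime m) :=
    IsLocalization.map_nonZeroDivisors_le m.primeCompl _ ⟨_, hreg p hp0, rfl⟩
  refine hdim.trans ?_
  exact_mod_cast one_le_localDepth
    ((IsLocalization.AtPrime.to_map_mem_maximal_iff _ m _).2 hpm) hmem

theorem ker_constantCoeff_le {I : Ideal (MvPolynomial (Fin d) K)} (hI : ∀ i, X i ∈ I)
    {f : MvPolynomial (Fin d) K} (hf : constantCoeff f = 0) : f ∈ I := by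
  have key : ∀ g : MvPolynomial (Fin d) K, g - C (constantCoeff g) ∈ I := by
    intro g
    induction g using MvPolynomial.induction_on with
    | C a => simp
    | add p q hp hq =>
      rw [map_add, map_add, add_sub_add_comm]
      exact Ideal.add_mem _ hp hq
    | mul_X p i _ => simpa using Ideal.mul_mem_left _ _ (hI i)
  simpa [hf] using key f

/-- If $x_{i_0}$ kills some $h\ne0$, an associated prime $P$ containing the annihilator of $h$
contains all the variables, so it is the maximal ideal at the origin and the depth there is $0$. But
$\ker\psi$ is a prime strictly inside $P$, so the height of $P$ is positive. -/
theorem mem_nonZeroDivisors_of_isCohenMacaulayRing (hφ : Function.Surjective φ)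
    (hnil : ∀ j, j ≠ i₀ → IsNilpotent (φ (X j))) (ψ : R →ₐ[K] Polynomial K)
    (hψ : ψ.comp φ = axisProj K i₀) (hCM : IsCohenMacaulayRing R) :
    φ (X i₀) ∈ nonZeroDivisors R := by
  have hN := hCM.1
  rw [mem_nonZeroDivisors_iff_right]
  intro h hh
  by_contra h0
  obtain ⟨P, hP, hle⟩ := exists_le_isAssociatedPrime_of_isNoetherianRing R h h0
  obtain ⟨hprime, z, hz⟩ := isAssociatedPrime_iff.1 hP
  have hmemP : ∀ r, r ∈ P ↔ r * z = 0 := by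
    intro r
    rw [hz, Submodule.mem_colon_singleton]
    simp
  have hX : ∀ i, φ (X i) ∈ P := by
    intro i
    by_cases hi : i = i₀
    · refine hle ?_
      rw [hi, Submodule.mem_colon_singleton]
      simpa [mul_comm] using hh
    · exact nilradical_le_prime P (mem_nilradical.2 (hnil i hi))
  have hker : ∀ f, constantCoeff f = 0 → φ f ∈ P := fun f hf =>
    ker_constantCoeff_le (I := P.comap φ.toRingHom) hX hf
  have hmax : P.IsMaximal := by
    refine Ideal.Quotient.maximal_of_isField _ ?_
    have hs : Function.Surjective (algebraMap K (R ⧸ P)) := by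
      intro b
      obtain ⟨r, rfl⟩ := Ideal.Quotient.mk_surjective b
      obtain ⟨f, rfl⟩ := hφ r
      refine ⟨constantCoeff f, ?_⟩
      rw [eq_comm, ← sub_eq_zero]
      have := hker (f - C (constantCoeff f)) (by simp)
      rw [map_sub, ← algebraMap_eq, AlgHom.commutes] at this
      exact Ideal.Quotient.eq_zero_iff_mem.2 this
    exact (RingEquiv.ofBijective _ ⟨(algebraMap K (R ⧸ P)).injective, hs⟩).symm.toMulEquiv.isField
      (Field.toIsField K)
  have hz0 : algebraMap R (Localization.AtPrime P) z ≠ 0 := by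
    intro h
    rw [IsLocalization.map_eq_zero_iff P.primeCompl] at h
    obtain ⟨⟨c, hc⟩, hcz⟩ := h
    exact hc ((hmemP c).2 hcz)
  have hdepth : localDepth (Localization.AtPrime P) = 0 := by
    refine localDepth_eq_zero hz0 fun r hr => ?_
    rw [← Localization.AtPrime.map_eq_maximalIdeal] at hr
    induction hr using Submodule.span_induction with
    | mem x hx =>
      obtain ⟨y, hy, rfl⟩ := hx
      rw [← map_mul, (hmemP y).1 hy, map_zero]
    | zero => simp
    | add x y _ _ hx hy => rw [add_mul, hx, hy, add_zero]
    | smul a x _ hx => rw [smul_eq_mul, mul_assoc, hx, mul_zero]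
  have hdim := hCM.2 P
  rw [hdepth, IsLocalization.AtPrime.ringKrullDim_eq_height P] at hdim
  have hψX : ψ (φ (X i₀)) = Polynomial.X := by
    rw [← AlgHom.comp_apply, hψ]
    simp [axisProj]
  have hlt : RingHom.ker ψ < P := by
    refine lt_of_le_of_ne (fun r hr => ?_) fun h => ?_
    · obtain ⟨f, rfl⟩ := hφ r
      refine hker f ?_
      have h1 : axisProj K i₀ f = 0 := by rw [← hψ]; exact hr
      have h2 : (constantCoeff : MvPolynomial (Fin d) K →+* K) =
          Polynomial.constantCoeff.comp (axisProj K i₀).toRingHom := by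
        refine MvPolynomial.ringHom_ext (fun a => ?_) fun i => ?_
        · simp [axisProj]
        · by_cases hi : i = i₀ <;> simp [axisProj, hi]
      rw [h2]
      change Polynomial.constantCoeff (axisProj K i₀ f) = 0
      rw [h1, map_zero]
    · have := hX i₀
      rw [← h, RingHom.mem_ker, hψX] at this
      exact Polynomial.X_ne_zero this
  have hpr : (RingHom.ker ψ).IsPrime := RingHom.ker_isPrime _
  have h1 := Ideal.height_add_one_le_of_lt_of_isPrime hlt
  have h2 : P.height = 0 := by exact_mod_cast hdim.symm
  rw [h2] at h1
  simp at h1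

end AxisAlgebra

/-! ### Cohen–Macaulayness as a condition on degrees -/

section TangentCone

variable {K : Type*} [Field K] {d : ℕ} {n : Fin d → ℕ}

theorem sum_mul_eq_weight (n : Fin d → ℕ) (e : Fin d →₀ ℕ) :
    Finsupp.weight n e = ∑ i, e i * n i := by
  simp [Finsupp.weight_eq_sum]

theorem isMaxDeg_single {i₀ : Fin d} (hpos : ∀ i, 0 < n i) (hmin : ∀ j, j ≠ i₀ → n i₀ < n j)
    (k : ℕ) {g : Fin d →₀ ℕ} (hg : Finsupp.weight n g = k * n i₀) :
    g.degree ≤ k ∧ (g.degree = k → g = Finsupp.single i₀ k) := by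
  rw [sum_mul_eq_weight] at hg
  have hle : ∀ i ∈ Finset.univ, g i * n i₀ ≤ g i * n i := by
    intro i _
    by_cases h : i = i₀
    · rw [h]
    · exact Nat.mul_le_mul_left _ (hmin i h).le
  have hdeg : g.degree * n i₀ = ∑ i, g i * n i₀ := by
    rw [Finsupp.degree_eq_sum, Finset.sum_mul]
  have h1 : g.degree * n i₀ ≤ k * n i₀ := by
    rw [hdeg, ← hg]
    exact Finset.sum_le_sum hle
  refine ⟨Nat.le_of_mul_le_mul_right h1 (hpos i₀), fun hk => ?_⟩
  have h2 : ∑ i, g i * n i₀ = ∑ i, g i * n i := by rw [← hdeg, hg, hk]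
  have h3 := (Finset.sum_eq_sum_iff_of_le hle).1 h2
  have h4 : ∀ j, j ≠ i₀ → g j = 0 := by
    intro j hj
    by_contra h0
    have := h3 j (Finset.mem_univ _)
    exact absurd (Nat.eq_of_mul_eq_mul_left (Nat.pos_of_ne_zero h0) this) (hmin j hj).ne
  have h5 : g i₀ = k := by
    rw [← hk, Finsupp.degree_eq_sum, Finset.sum_eq_single i₀ (fun j _ hj => h4 j hj) (by simp)]
  ext j
  by_cases hj : j = i₀
  · simp [hj, h5]
  · simp [h4 j hj, Ne.symm hj]

/-- As $n_{i_0}$ is the strict minimum, $x_{i_0}^k$ is the only monomial of largest degree in weight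
$k\,n_{i_0}$. Hence projection to the axis factors through the tangent cone. -/
theorem axisProj_coeff {i₀ : Fin d} (hpos : ∀ i, 0 < n i) (hmin : ∀ j, j ≠ i₀ → n i₀ < n j)
    (f : MvPolynomial (Fin d) K) (k : ℕ) :
    (axisProj K i₀ f).coeff k = (orderSymbol K n f).coeff (k * n i₀) := by
  classical
  induction f using MvPolynomial.induction_on' with
  | add p q hp hq => simp [hp, hq]
  | monomial e c =>
    have hw : Finsupp.weight n (Finsupp.single i₀ k) = k * n i₀ := by
      simp [Finsupp.weight_single]
    rw [axisProj, aeval_monomial, orderSymbol_monomial, Finsupp.prod_fintype _ _ (by simp)]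
    by_cases he : ∀ j, j ≠ i₀ → e j = 0
    · have he' : e = Finsupp.single i₀ (e i₀) := by
        ext j
        by_cases hj : j = i₀
        · simp [hj]
        · simp [he j hj, Ne.symm hj]
      have hmax : IsMaxDeg n e := by
        intro g hg
        rw [he', Finsupp.weight_single] at hg
        rw [he', Finsupp.degree_single]
        exact (isMaxDeg_single hpos hmin _ hg).1
      rw [if_pos hmax, Finset.prod_eq_single i₀ (fun j _ hj => by simp [he j hj]) (by simp)]
      conv_rhs => rw [he', Finsupp.weight_single]
      simp only [if_true, smul_eq_mul, Polynomial.coeff_monomial, Polynomial.algebraMap_eq,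
        Polynomial.coeff_C_mul_X_pow]
      have : e i₀ * n i₀ = k * n i₀ ↔ k = e i₀ := by
        rw [Nat.mul_left_inj (hpos i₀).ne', eq_comm]
      simp only [this]
    · push Not at he
      obtain ⟨j, hj, hej⟩ := he
      rw [Finset.prod_eq_zero (Finset.mem_univ j) (by simp [hj, hej])]
      split_ifs with hm
      · rw [Polynomial.coeff_monomial, if_neg]
        · simp
        · intro hwe
          have h1 := isMaxDeg_single hpos hmin _ hwe
          have h2 := hm _ (hw.trans hwe.symm)
          rw [Finsupp.degree_single] at h2
          have h3 := h1.2 (le_antisymm h1.1 h2)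
          exact hej (by rw [h3, Finsupp.single_apply, if_neg (Ne.symm hj)])
      · simp

theorem axisProj_eq_zero {i₀ : Fin d} (hpos : ∀ i, 0 < n i) (hmin : ∀ j, j ≠ i₀ → n i₀ < n j)
    {f : MvPolynomial (Fin d) K} (hf : f ∈ tangentConeIdeal (toricIdeal K n)) :
    axisProj K i₀ f = 0 := by
  ext k
  rw [axisProj_coeff hpos hmin, (mem_tangentConeIdeal_iff hpos).1 hf]
  simp

theorem X_pow_mem_tangentConeIdeal {i₀ j : Fin d} (h : n i₀ < n j) :
    (X j ^ n i₀ : MvPolynomial (Fin d) K) ∈ tangentConeIdeal (toricIdeal K n) := by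
  rw [X_pow_eq_monomial]
  exact monomial_mem_tangentConeIdeal (g := Finsupp.single i₀ (n j)) (by simpa using h)
    (by simp [Finsupp.weight_single, mul_comm])

theorem isNilpotent_mk_X {i₀ j : Fin d} (h : n i₀ < n j) :
    IsNilpotent (Ideal.Quotient.mk (tangentConeIdeal (toricIdeal K n)) (X j)) :=
  ⟨n i₀, by rw [← map_pow, Ideal.Quotient.eq_zero_iff_mem]; exact X_pow_mem_tangentConeIdeal h⟩

/-- Under `hstep`, multiplication by $x_{i_0}$ becomes multiplication by $t^{n_{i_0}}$ on symbols.
Since $K[t]$ is a domain, nonzero polynomials in $x_{i_0}$ are then regular on the tangent cone. -/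
theorem orderSymbol_aeval_mul {i₀ : Fin d}
    (hstep : ∀ e, IsMaxDeg n e → IsMaxDeg n (e + Finsupp.single i₀ 1))
    (p : Polynomial K) (f : MvPolynomial (Fin d) K) :
    orderSymbol K n (Polynomial.aeval (X i₀) p * f) =
      Polynomial.expand K (n i₀) p * orderSymbol K n f := by
  classical
  have hX : ∀ f, orderSymbol K n (X i₀ * f) = Polynomial.X ^ n i₀ * orderSymbol K n f := by
    intro f
    induction f using MvPolynomial.induction_on' with
    | add p q hp hq => rw [mul_add, map_add, hp, hq, map_add, mul_add]
    | monomial e c =>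
      have hiff : IsMaxDeg n (Finsupp.single i₀ 1 + e) ↔ IsMaxDeg n e :=
        ⟨fun h => (add_comm _ e ▸ h).of_le, fun h => add_comm e _ ▸ hstep e h⟩
      rw [X, monomial_mul, one_mul, orderSymbol_monomial, orderSymbol_monomial]
      simp only [hiff]
      split_ifs
      · rw [← Polynomial.monomial_one_right_eq_X_pow, Polynomial.monomial_mul_monomial, one_mul]
        simp [Finsupp.weight_single]
      · simp
  induction p using Polynomial.induction_on' with
  | add p q hp hq => rw [map_add, add_mul, map_add, hp, hq, map_add, add_mul]
  | monomial k c =>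
    have hpow : ∀ f, orderSymbol K n (X i₀ ^ k * f) =
        Polynomial.X ^ (n i₀ * k) * orderSymbol K n f := by
      induction k with
      | zero => simp
      | succ k ih =>
        intro f
        rw [pow_succ, mul_assoc, ih, hX, mul_add, pow_add, mul_one, mul_assoc]
    rw [Polynomial.aeval_monomial, Polynomial.expand_monomial, algebraMap_eq, mul_assoc,
      ← smul_eq_C_mul, map_smul, hpow, ← Polynomial.C_mul_X_pow_eq_monomial, mul_assoc,
      Polynomial.smul_eq_C_mul, mul_comm k]

theorem isCohenMacaulayRing_tangentCone_iff {i₀ : Fin d} (hpos : ∀ i, 0 < n i)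
    (hmin : ∀ j, j ≠ i₀ → n i₀ < n j) :
    IsCohenMacaulayRing (TangentCone K n) ↔
      ∀ e, IsMaxDeg n e → IsMaxDeg n (e + Finsupp.single i₀ 1) := by
  let φ : MvPolynomial (Fin d) K →ₐ[K] TangentCone K n := Ideal.Quotient.mkₐ K _
  have hφ : Function.Surjective φ := Ideal.Quotient.mkₐ_surjective K _
  have hnil : ∀ j, j ≠ i₀ → IsNilpotent (φ (X j)) := fun j hj => isNilpotent_mk_X (hmin j hj)
  have hzero : ∀ f, φ f = 0 ↔ orderSymbol K n f = 0 := fun f =>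
    Ideal.Quotient.eq_zero_iff_mem.trans (mem_tangentConeIdeal_iff hpos)
  constructor
  · intro hCM e he
    let ψ : TangentCone K n →ₐ[K] Polynomial K :=
      Ideal.Quotient.liftₐ _ (axisProj K i₀) fun f hf => axisProj_eq_zero hpos hmin hf
    have hψ : ψ.comp φ = axisProj K i₀ := Ideal.Quotient.liftₐ_comp _ _ _
    have hreg := mem_nonZeroDivisors_of_isCohenMacaulayRing hφ hnil ψ hψ hCM
    by_contra hne
    have h1 : φ (monomial e 1) * φ (X i₀) = 0 := by
      rw [← map_mul, hzero, X, monomial_mul, orderSymbol_monomial_of_not_isMaxDeg hne]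
    have h2 := (mem_nonZeroDivisors_iff_right.1 hreg) _ h1
    rw [hzero, orderSymbol_monomial_of_isMaxDeg he] at h2
    simp at h2
  · intro hstep
    refine isCohenMacaulayRing_of_aeval_mem_nonZeroDivisors hφ hnil fun p hp => ?_
    rw [mem_nonZeroDivisors_iff_left]
    intro r hr
    obtain ⟨f, rfl⟩ := hφ r
    rw [Polynomial.aeval_algHom_apply, ← map_mul, hzero, orderSymbol_aeval_mul hstep,
      mul_eq_zero] at hr
    rw [hzero]
    refine hr.resolve_left ?_
    rwa [Polynomial.expand_eq_zero (hpos i₀)]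

theorem forall_isMaxDeg_add_single_iff {i₀ : Fin d} (hpos : ∀ i, 0 < n i) :
    (∀ e, IsMaxDeg n e → IsMaxDeg n (e + Finsupp.single i₀ 1)) ↔
      ∀ e g : Fin d →₀ ℕ, Finsupp.weight n g = Finsupp.weight n e + n i₀ →
        ∃ e' : Fin d →₀ ℕ, Finsupp.weight n e' = Finsupp.weight n e ∧
          g.degree ≤ e'.degree + 1 := by
  constructor
  · intro h e g hg
    obtain ⟨e', hw, hm⟩ := exists_isMaxDeg hpos e
    refine ⟨e', hw, ?_⟩
    have := h e' hm g (by rw [hg, map_add, hw, Finsupp.weight_single, one_smul])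
    simpa using this
  · intro h e he g hg
    rw [map_add, Finsupp.weight_single, one_smul] at hg
    obtain ⟨e', hw, hd⟩ := h e g hg
    have := he e' hw
    rw [map_add, Finsupp.degree_single]
    omega

end TangentCone

/-! ### Functionals that vanish on binomial ideals -/

section Binomials

/-- `P` is invariant under exchanging the two monomials of each of the five binomials. -/
structure IsMoveInvariant (a₁ a₂ a₃ a₄ a₁₂ a₁₃ a₂₃ a₂₄ a₃₁ a₃₄ a₄₁ a₄₂ : ℕ)
    (P : ℕ → ℕ → ℕ → ℕ → Prop) : Prop where
  iff₁ : ∀ b c d e, P (b + a₁) c d e ↔ P b (c + a₁₂) (d + a₁₃) e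
  iff₂ : ∀ b c d e, P b (c + a₂) d e ↔ P b c (d + a₂₃) (e + a₂₄)
  iff₃ : ∀ b c d e, P b c (d + a₃) e ↔ P (b + a₃₁) c d (e + a₃₄)
  iff₄ : ∀ b c d e, P b c d (e + a₄) ↔ P (b + a₄₁) (c + a₄₂) d e
  iff₅ : ∀ b c d e, P (b + a₄₁) c (d + a₂₃) e ↔ P b (c + a₁₂) d (e + a₃₄)

/-- The exponent of `x₁ ^ b * x₂ ^ c * x₃ ^ d * x₄ ^ e`. -/
noncomputable def exponent (b c d e : ℕ) : Fin 4 →₀ ℕ := Finsupp.equivFunOnFinite.symm ![b, c, d, e]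

theorem exponent_eta (u : Fin 4 →₀ ℕ) : exponent (u 0) (u 1) (u 2) (u 3) = u := by
  ext i
  fin_cases i <;> rfl

theorem weight_exponent (n : Fin 4 → ℕ) (b c d e : ℕ) :
    Finsupp.weight n (exponent b c d e) = b * n 0 + c * n 1 + d * n 2 + e * n 3 := by
  simp [exponent, Finsupp.weight_eq_sum, Fin.sum_univ_four]

theorem degree_exponent (b c d e : ℕ) : (exponent b c d e).degree = b + c + d + e := by
  simp [exponent, Finsupp.degree_eq_sum, Fin.sum_univ_four]

variable {K : Type*} [Field K]

theorem monomial_exponent (b c d e : ℕ) :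
    (monomial (exponent b c d e) 1 : MvPolynomial (Fin 4) K) =
      X 0 ^ b * X 1 ^ c * X 2 ^ d * X 3 ^ e := by
  rw [monomial_eq, Finsupp.prod_fintype _ _ (by simp)]
  simp [exponent, Fin.prod_univ_four]

open Classical in
/-- The sum of the coefficients of the monomials whose exponents satisfy `P`. -/
noncomputable def coeffSum (K : Type*) [Field K] (P : ℕ → ℕ → ℕ → ℕ → Prop) :
    MvPolynomial (Fin 4) K →ₗ[K] K :=
  (basisMonomials (Fin 4) K).constr K (fun u => if P (u 0) (u 1) (u 2) (u 3) then 1 else 0)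

open Classical in
theorem coeffSum_monomial (P : ℕ → ℕ → ℕ → ℕ → Prop) (u : Fin 4 →₀ ℕ) (t : K) :
    coeffSum K P (monomial u t) = if P (u 0) (u 1) (u 2) (u 3) then t else 0 := by
  have h1 := (basisMonomials (Fin 4) K).constr_basis K
    (fun u => if P (u 0) (u 1) (u 2) (u 3) then (1 : K) else 0) u
  rw [coe_basisMonomials] at h1
  have : (monomial u t : MvPolynomial (Fin 4) K) = t • monomial u 1 := by
    simp [smul_monomial]
  rw [this, map_smul, coeffSum, h1]
  simp

theorem coeffSum_mul_binomial (P : ℕ → ℕ → ℕ → ℕ → Prop) {b c d e b' c' d' e' : ℕ}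
    (h : ∀ i j k l, P (i + b) (j + c) (k + d) (l + e) ↔ P (i + b') (j + c') (k + d') (l + e'))
    (f : MvPolynomial (Fin 4) K) :
    coeffSum K P (f * (monomial (exponent b c d e) 1 - monomial (exponent b' c' d' e') 1)) = 0 := by
  classical
  induction f using MvPolynomial.induction_on' with
  | add p q hp hq => rw [add_mul, map_add, hp, hq, add_zero]
  | monomial u t =>
    rw [mul_sub, monomial_mul, monomial_mul, map_sub, coeffSum_monomial, coeffSum_monomial,
      sub_eq_zero]
    exact if_congr (h (u 0) (u 1) (u 2) (u 3)) rfl rfl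

theorem coeffSum_eq_zero_of_mem_span {P : ℕ → ℕ → ℕ → ℕ → Prop} {G : Set (MvPolynomial (Fin 4) K)}
    (hG : ∀ g ∈ G, ∀ f, coeffSum K P (f * g) = 0) {f : MvPolynomial (Fin 4) K}
    (hf : f ∈ Ideal.span G) : coeffSum K P f = 0 := by
  have : ∀ h, coeffSum K P (h * f) = 0 := by
    induction hf using Submodule.span_induction with
    | mem x hx => exact hG x hx
    | zero => simp
    | add x y _ _ hx hy => intro h; rw [mul_add, map_add, hx, hy, add_zero]
    | smul a x _ hx => intro h; rw [smul_eq_mul, ← mul_assoc, hx]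
  simpa using this 1

end Binomials

/-! ### Weight classes and exponent identities in case 2(a) -/

namespace IsGorensteinCase2a

variable {K : Type*} [Field K] {n : Fin 4 → ℕ}
  {a₁ a₂ a₃ a₄ a₁₂ a₁₃ a₂₃ a₂₄ a₃₁ a₃₄ a₄₁ a₄₂ : ℕ}

/-- The coefficient sum over an invariant set vanishes on multiples of the generators, hence on
$I(C)$. On a difference of two monomials of equal weight, with only the first in the set, it would
be $1$. -/
theorem of_isMoveInvariant (hI : IsGorensteinCase2a K n a₁ a₂ a₃ a₄ a₁₂ a₁₃ a₂₃ a₂₄ a₃₁ a₃₄ a₄₁ a₄₂)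
    {P : ℕ → ℕ → ℕ → ℕ → Prop}
    (hP : IsMoveInvariant a₁ a₂ a₃ a₄ a₁₂ a₁₃ a₂₃ a₂₄ a₃₁ a₃₄ a₄₁ a₄₂ P)
    {b c d e b' c' d' e' : ℕ} (h : P b c d e)
    (hw : b * n 0 + c * n 1 + d * n 2 + e * n 3 = b' * n 0 + c' * n 1 + d' * n 2 + e' * n 3) :
    P b' c' d' e' := by
  have hmem : (monomial (exponent b c d e) 1 - monomial (exponent b' c' d' e') 1 :
      MvPolynomial (Fin 4) K) ∈ toricIdeal K n := by
    rw [monomial_sub_monomial_mem_toricIdeal, weight_exponent, weight_exponent, hw]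
  rw [← hI.generators.1] at hmem
  have h0 := coeffSum_eq_zero_of_mem_span (P := P) ?_ hmem
  · by_contra hne
    have h1 : P (exponent b c d e 0) (exponent b c d e 1) (exponent b c d e 2)
      (exponent b c d e 3) := h
    have h2 : ¬ P (exponent b' c' d' e' 0) (exponent b' c' d' e' 1) (exponent b' c' d' e' 2)
      (exponent b' c' d' e' 3) := hne
    rw [map_sub, coeffSum_monomial, coeffSum_monomial, if_pos h1, if_neg h2] at h0
    simp at h0
  · intro g hg f
    simp only [Set.mem_insert_iff, Set.mem_singleton_iff] at hg
    rcases hg with rfl | rfl | rfl | rfl | rfl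
    · simpa [monomial_exponent] using coeffSum_mul_binomial (K := K) P (b := a₁) (c := 0) (d := 0)
        (e := 0) (b' := 0) (c' := a₁₂) (d' := a₁₃) (e' := 0) hP.iff₁ f
    · simpa [monomial_exponent] using coeffSum_mul_binomial (K := K) P (b := 0) (c := a₂) (d := 0)
        (e := 0) (b' := 0) (c' := 0) (d' := a₂₃) (e' := a₂₄) hP.iff₂ f
    · simpa [monomial_exponent] using coeffSum_mul_binomial (K := K) P (b := 0) (c := 0) (d := a₃)
        (e := 0) (b' := a₃₁) (c' := 0) (d' := 0) (e' := a₃₄) hP.iff₃ f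
    · simpa [monomial_exponent] using coeffSum_mul_binomial (K := K) P (b := 0) (c := 0) (d := 0)
        (e := a₄) (b' := a₄₁) (c' := a₄₂) (d' := 0) (e' := 0) hP.iff₄ f
    · simpa [monomial_exponent] using coeffSum_mul_binomial (K := K) P (b := a₄₁) (c := 0) (d := a₂₃)
        (e := 0) (b' := 0) (c' := a₁₂) (d' := 0) (e' := a₃₄) hP.iff₅ f

theorem weight_eq_of_mem {b c d e b' c' d' e' : ℕ}
    (h : (monomial (exponent b c d e) 1 - monomial (exponent b' c' d' e') 1 :
      MvPolynomial (Fin 4) K) ∈ toricIdeal K n) :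
    b * n 0 + c * n 1 + d * n 2 + e * n 3 = b' * n 0 + c' * n 1 + d' * n 2 + e' * n 3 := by
  rwa [monomial_sub_monomial_mem_toricIdeal, weight_exponent, weight_exponent] at h

/-- The relations between the weights given by the five binomials. -/
theorem weights (hI : IsGorensteinCase2a K n a₁ a₂ a₃ a₄ a₁₂ a₁₃ a₂₃ a₂₄ a₃₁ a₃₄ a₄₁ a₄₂) :
    a₁ * n 0 = a₁₂ * n 1 + a₁₃ * n 2 ∧ a₂ * n 1 = a₂₃ * n 2 + a₂₄ * n 3 ∧
      a₃ * n 2 = a₃₁ * n 0 + a₃₄ * n 3 ∧ a₄ * n 3 = a₄₁ * n 0 + a₄₂ * n 1 ∧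
      a₄₁ * n 0 + a₂₃ * n 2 = a₁₂ * n 1 + a₃₄ * n 3 := by
  have hs : ∀ g ∈ ({X 0 ^ a₁ - X 1 ^ a₁₂ * X 2 ^ a₁₃, X 1 ^ a₂ - X 2 ^ a₂₃ * X 3 ^ a₂₄,
      X 2 ^ a₃ - X 0 ^ a₃₁ * X 3 ^ a₃₄, X 3 ^ a₄ - X 0 ^ a₄₁ * X 1 ^ a₄₂,
      X 0 ^ a₄₁ * X 2 ^ a₂₃ - X 1 ^ a₁₂ * X 3 ^ a₃₄} : Set (MvPolynomial (Fin 4) K)),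
      g ∈ toricIdeal K n := fun g hg => hI.generators.1 ▸ Ideal.subset_span hg
  refine ⟨?_, ?_, ?_, ?_, ?_⟩
  · simpa using weight_eq_of_mem (K := K) (n := n) (b := a₁) (c := 0) (d := 0) (e := 0)
      (b' := 0) (c' := a₁₂) (d' := a₁₃) (e' := 0)
      (by simpa [monomial_exponent] using hs _ (by simp))
  · simpa using weight_eq_of_mem (K := K) (n := n) (b := 0) (c := a₂) (d := 0) (e := 0)
      (b' := 0) (c' := 0) (d' := a₂₃) (e' := a₂₄)
      (by simpa [monomial_exponent] using hs _ (by simp))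
  · simpa using weight_eq_of_mem (K := K) (n := n) (b := 0) (c := 0) (d := a₃) (e := 0)
      (b' := a₃₁) (c' := 0) (d' := 0) (e' := a₃₄)
      (by simpa [monomial_exponent] using hs _ (by simp))
  · simpa using weight_eq_of_mem (K := K) (n := n) (b := 0) (c := 0) (d := 0) (e := a₄)
      (b' := a₄₁) (c' := a₄₂) (d' := 0) (e' := 0)
      (by simpa [monomial_exponent] using hs _ (by simp))
  · simpa using weight_eq_of_mem (K := K) (n := n) (b := a₄₁) (c := 0) (d := a₂₃) (e := 0)
      (b' := 0) (c' := a₁₂) (d' := 0) (e' := a₃₄)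
      (by simpa [monomial_exponent] using hs _ (by simp))

theorem mul_x₃_ne (hI : IsGorensteinCase2a K n a₁ a₂ a₃ a₄ a₁₂ a₁₃ a₂₃ a₂₄ a₃₁ a₃₄ a₄₁ a₄₂)
    (k j : ℕ) (hk : 0 < k) (hk' : k < a₃) : k * n 2 ≠ j * n 0 := by
  intro h
  -- No monomial occurring in the generators divides $x_3^k$ when $k<a_3$, so $x_3^k$ is alone in
  -- its weight.
  have := hI.of_isMoveInvariant (P := fun b c d e => b = 0 ∧ c = 0 ∧ d = k ∧ e = 0)
    (b := 0) (c := 0) (d := k) (e := 0) (b' := j) (c' := 0) (d' := 0) (e' := 0) ?_ (by simp)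
    (by simpa using h)
  · omega
  · obtain ⟨h1, h2, h3, h4, h5, h6, h7, h8, -⟩ := hI
    constructor <;> intros <;> omega

theorem mul_x₂_ne (hI : IsGorensteinCase2a K n a₁ a₂ a₃ a₄ a₁₂ a₁₃ a₂₃ a₂₄ a₃₁ a₃₄ a₄₁ a₄₂)
    (k j : ℕ) (hk : 0 < k) (hk' : k < a₂) : k * n 1 ≠ j * n 3 := by
  intro h
  have := hI.of_isMoveInvariant (P := fun b c d e => b = 0 ∧ c = k ∧ d = 0 ∧ e = 0)
    (b := 0) (c := k) (d := 0) (e := 0) (b' := 0) (c' := 0) (d' := 0) (e' := j) ?_ (by simp)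
    (by simpa using h)
  · omega
  · obtain ⟨h1, h2, h3, h4, h5, h6, h7, h8, -⟩ := hI
    constructor <;> intros <;> omega

theorem eq_and_eq_of_add_mul_eq {m p A u v w : ℕ} (hm : 0 < m)
    (hA : ∀ k j, 0 < k → k < A → k * p ≠ j * m) (h : u * m + A * p = v * m + w * p) (hw : 0 < w)
    (hw' : w < 2 * A) : w = A ∧ u = v := by
  rcases lt_trichotomy w A with hlt | rfl | hlt
  · obtain ⟨k, rfl⟩ := Nat.exists_eq_add_of_lt hlt
    have hle : u ≤ v := by
      refine Nat.le_of_mul_le_mul_right (c := m) ?_ hm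
      nlinarith
    obtain ⟨j, rfl⟩ := Nat.exists_eq_add_of_le hle
    exact absurd (by linarith) (hA (k + 1) j (by omega) (by omega))
  · exact ⟨rfl, Nat.eq_of_mul_eq_mul_right hm (by omega)⟩
  · obtain ⟨k, rfl⟩ := Nat.exists_eq_add_of_lt hlt
    have hle : v ≤ u := by
      refine Nat.le_of_mul_le_mul_right (c := m) ?_ hm
      nlinarith
    obtain ⟨j, rfl⟩ := Nat.exists_eq_add_of_le hle
    exact absurd (by linarith) (hA (k + 1) j (by omega) (by omega))

/-- Combining the weight relations of $f_1,f_3,f_5$ leaves only $n_1$ and $n_3$; those of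
$f_2,f_4,f_5$ leave only $n_2$ and $n_4$. As $a_{13}+a_{23}<2a_3$, a mismatch would make some $kn_3$
with $0<k<a_3$ a multiple of $n_1$; likewise for $n_2$ and $n_4$. -/
theorem exponent_identities (hpos : ∀ i, 0 < n i)
    (hI : IsGorensteinCase2a K n a₁ a₂ a₃ a₄ a₁₂ a₁₃ a₂₃ a₂₄ a₃₁ a₃₄ a₄₁ a₄₂) :
    a₁ = a₃₁ + a₄₁ ∧ a₂ = a₁₂ + a₄₂ ∧ a₃ = a₁₃ + a₂₃ ∧ a₄ = a₂₄ + a₃₄ := by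
  obtain ⟨w1, w2, w3, w4, w5⟩ := hI.weights
  have h3 := eq_and_eq_of_add_mul_eq (hpos 0) hI.mul_x₃_ne (u := a₁) (v := a₃₁ + a₄₁)
    (w := a₁₃ + a₂₃) (by linarith) (by linarith [hI.bound₁₃.1])
    (by linarith [hI.bound₁₃.2, hI.bound₂₃.2])
  have h2 := eq_and_eq_of_add_mul_eq (hpos 3) hI.mul_x₂_ne (u := a₄) (v := a₂₄ + a₃₄)
    (w := a₁₂ + a₄₂) (by linarith) (by linarith [hI.bound₁₂.1])
    (by linarith [hI.bound₁₂.2, hI.bound₄₂.2])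
  omega

/-- For each monomial with the weight of a multiple of `x₁` there is a multiple of `x₁` of the same
weight and no smaller degree. -/
def HasMultipleOfX₁ (n : Fin 4 → ℕ) : Prop :=
  ∀ b c d e b' c' d' e' : ℕ,
    b * n 0 + c * n 1 + d * n 2 + e * n 3 = (b' + 1) * n 0 + c' * n 1 + d' * n 2 + e' * n 3 →
    ∃ i j k l : ℕ, b * n 0 + c * n 1 + d * n 2 + e * n 3 =
      (i + 1) * n 0 + j * n 1 + k * n 2 + l * n 3 ∧ b + c + d + e ≤ i + 1 + j + k + l

theorem isCohenMacaulayRing_iff_hasMultipleOfX₁ (hpos : ∀ i, 0 < n i) (hmono : StrictMono n) :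
    IsCohenMacaulayRing (TangentCone K n) ↔ HasMultipleOfX₁ n := by
  rw [isCohenMacaulayRing_tangentCone_iff (i₀ := 0) hpos
    (fun j hj => hmono (Fin.pos_iff_ne_zero.2 hj)), forall_isMaxDeg_add_single_iff hpos]
  constructor
  · intro h b c d e b' c' d' e' hw
    obtain ⟨u, hu, hd⟩ := h (exponent b' c' d' e') (exponent b c d e)
      (by rw [weight_exponent, weight_exponent, hw]; ring)
    rw [← exponent_eta u, weight_exponent, weight_exponent] at hu
    rw [← exponent_eta u, degree_exponent, degree_exponent] at hd
    exact ⟨u 0, u 1, u 2, u 3, by linarith, by omega⟩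
  · intro h u v hw
    rw [← exponent_eta u, ← exponent_eta v, weight_exponent, weight_exponent] at hw
    obtain ⟨i, j, k, l, h1, h2⟩ := h _ _ _ _ (u 0) (u 1) (u 2) (u 3) (hw.trans (by ring))
    refine ⟨exponent i j k l, ?_, ?_⟩
    · rw [← exponent_eta u, weight_exponent, weight_exponent]
      linarith
    · rw [← exponent_eta v, degree_exponent, degree_exponent]
      omega

/-! ### Necessity of the three conditions -/

theorem exists_of_hasMultipleOfX₁ (h : HasMultipleOfX₁ n)
    (hI : IsGorensteinCase2a K n a₁ a₂ a₃ a₄ a₁₂ a₁₃ a₂₃ a₂₄ a₃₁ a₃₄ a₄₁ a₄₂)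
    {P : ℕ → ℕ → ℕ → ℕ → Prop}
    (hP : IsMoveInvariant a₁ a₂ a₃ a₄ a₁₂ a₁₃ a₂₃ a₂₄ a₃₁ a₃₄ a₄₁ a₄₂ P)
    {b c d e b' c' d' e' : ℕ} (hb : P b c d e) (hb' : 0 < b')
    (hw : b * n 0 + c * n 1 + d * n 2 + e * n 3 = b' * n 0 + c' * n 1 + d' * n 2 + e' * n 3) :
    ∃ i j k l, P (i + 1) j k l ∧ b + c + d + e ≤ i + 1 + j + k + l := by
  obtain ⟨b', rfl⟩ := Nat.exists_eq_succ_of_ne_zero hb'.ne'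
  obtain ⟨i, j, k, l, h1, h2⟩ := h _ _ _ _ _ _ _ _ hw
  exact ⟨i, j, k, l, hI.of_isMoveInvariant hP hb h1, h2⟩

theorem le_of_hasMultipleOfX₁ (h : HasMultipleOfX₁ n)
    (hI : IsGorensteinCase2a K n a₁ a₂ a₃ a₄ a₁₂ a₁₃ a₂₃ a₂₄ a₃₁ a₃₄ a₄₁ a₄₂) :
    a₃ ≤ a₃₁ + a₃₄ := by
  obtain ⟨w1, w2, w3, w4, w5⟩ := hI.weights
  obtain ⟨i, j, k, l, h1, h2⟩ := exists_of_hasMultipleOfX₁ h hI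
    (P := fun b c d e => (b = 0 ∧ c = 0 ∧ d = a₃ ∧ e = 0) ∨ (b = a₃₁ ∧ c = 0 ∧ d = 0 ∧ e = a₃₄))
    (b := 0) (c := 0) (d := a₃) (e := 0) (b' := a₃₁) (c' := 0) (d' := 0) (e' := a₃₄)
    (by obtain ⟨h1, h2, h3, h4, h5, h6, h7, h8, -⟩ := hI
        constructor <;> intros <;> omega)
    (by simp) hI.bound₃₁.1 (by linarith)
  omega

theorem add_le_of_hasMultipleOfX₁ (h : HasMultipleOfX₁ n)
    (hI : IsGorensteinCase2a K n a₁ a₂ a₃ a₄ a₁₂ a₁₃ a₂₃ a₂₄ a₃₁ a₃₄ a₄₁ a₄₂) :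
    a₁₂ + a₃₄ ≤ a₄₁ + a₂₃ := by
  obtain ⟨w1, w2, w3, w4, w5⟩ := hI.weights
  obtain ⟨i, j, k, l, h1, h2⟩ := exists_of_hasMultipleOfX₁ h hI
    (P := fun b c d e => (b = 0 ∧ c = a₁₂ ∧ d = 0 ∧ e = a₃₄) ∨
      (b = a₄₁ ∧ c = 0 ∧ d = a₂₃ ∧ e = 0))
    (b := 0) (c := a₁₂) (d := 0) (e := a₃₄) (b' := a₄₁) (c' := 0) (d' := a₂₃) (e' := 0)
    (by obtain ⟨h1, h2, h3, h4, h5, h6, h7, h8, -⟩ := hI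
        constructor <;> intros <;> omega)
    (by simp) hI.bound₄₁.1 (by linarith)
  omega

/-- The exponents of the monomials of the weight of `x₂ ^ (a₂ + a₁₂)`. -/
def ClassOfPowX₂ (a₁ a₂ a₃ a₁₂ a₁₃ a₂₃ a₂₄ a₃₁ a₃₄ b c d e : ℕ) : Prop :=
  (b = 0 ∧ c = a₂ + a₁₂ ∧ d = 0 ∧ e = 0) ∨ (b = 0 ∧ c = a₁₂ ∧ d = a₂₃ ∧ e = a₂₄) ∨
    ∃ k, c = 0 ∧ b + k * a₃₁ = a₁ ∧ d + a₁₃ = a₂₃ + k * a₃ ∧ e + k * a₃₄ = a₂₄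

/-- From $x_2^{a_2+a_{12}}$, $f_2$ leads to $x_2^{a_{12}}x_3^{a_{23}}x_4^{a_{24}}$. From there $f_1$
enters the $k$-family at $k=0$ (possible only if $a_{13}\le a_{23}$) and $f_5$ at $k=1$; $f_3$
changes $k$ by one. -/
theorem isMoveInvariant_classOfPowX₂ (hpos : ∀ i, 0 < n i)
    (hI : IsGorensteinCase2a K n a₁ a₂ a₃ a₄ a₁₂ a₁₃ a₂₃ a₂₄ a₃₁ a₃₄ a₄₁ a₄₂) :
    IsMoveInvariant a₁ a₂ a₃ a₄ a₁₂ a₁₃ a₂₃ a₂₄ a₃₁ a₃₄ a₄₁ a₄₂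
      (ClassOfPowX₂ a₁ a₂ a₃ a₁₂ a₁₃ a₂₃ a₂₄ a₃₁ a₃₄) := by
  obtain ⟨i1, i2, i3, i4⟩ := hI.exponent_identities hpos
  obtain ⟨h1, h2, h3, h4, h5, h6, h7, h8, -⟩ := hI
  constructor <;> intro b c d e
  · constructor
    · rintro (h | h | ⟨_ | k, h⟩)
      · omega
      · omega
      · exact Or.inr (Or.inl (by omega))
      · rw [add_mul] at h; omega
    · rintro (h | h | ⟨k, h⟩)
      · omega
      · exact Or.inr (Or.inr ⟨0, by omega⟩)
      · omega
  · constructor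
    · rintro (h | h | ⟨k, h⟩)
      · exact Or.inr (Or.inl (by omega))
      · omega
      · omega
    · rintro (h | h | ⟨_ | k, h⟩)
      · omega
      · exact Or.inl (by omega)
      · omega
      · rw [add_mul k 1 a₃₄] at h; omega
  · constructor
    · rintro (h | h | ⟨_ | k, h⟩)
      · omega
      · omega
      · omega
      · simp only [add_mul] at h
        exact Or.inr (Or.inr ⟨k, by omega⟩)
    · rintro (h | h | ⟨k, h⟩)
      · omega
      · omega
      · refine Or.inr (Or.inr ⟨k + 1, ?_⟩)
        simp only [add_mul]
        omega
  · constructor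
    · rintro (h | h | ⟨k, h⟩) <;> omega
    · rintro (h | h | ⟨k, h⟩) <;> omega
  · constructor
    · rintro (h | h | ⟨_ | _ | k, h⟩)
      · omega
      · omega
      · omega
      · exact Or.inr (Or.inl (by omega))
      · rw [add_mul, add_mul] at h; omega
    · rintro (h | h | ⟨k, h⟩)
      · omega
      · exact Or.inr (Or.inr ⟨1, by omega⟩)
      · omega

theorem add_le_cases_of_hasMultipleOfX₁ (hpos : ∀ i, 0 < n i) (h : HasMultipleOfX₁ n)
    (hI : IsGorensteinCase2a K n a₁ a₂ a₃ a₄ a₁₂ a₁₃ a₂₃ a₂₄ a₃₁ a₃₄ a₄₁ a₄₂) (ha : a₃₄ ≤ a₂₄) :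
    (a₂₃ < a₁₃ ∧ a₂ + a₁₂ ≤ a₄₁ + 2 * a₂₃ + (a₂₄ - a₃₄)) ∨
      (a₁₃ ≤ a₂₃ ∧ a₂ + a₁₂ ≤ a₁ + (a₂₃ - a₁₃) + a₂₄) := by
  obtain ⟨w1, w2, w3, w4, w5⟩ := hI.weights
  obtain ⟨i1, i2, i3, i4⟩ := hI.exponent_identities hpos
  have hle := le_of_hasMultipleOfX₁ h hI
  obtain ⟨t, ht⟩ := Nat.exists_eq_add_of_le ha
  -- The witness $x_1^{a_{41}}x_3^{2a_{23}}x_4^{a_{24}-a_{34}}$ is the member $k=1$, available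
  -- because $a_{34}\le a_{24}$.
  obtain ⟨i, j, k, l, hcl, hdeg⟩ := exists_of_hasMultipleOfX₁ h hI
    (hI.isMoveInvariant_classOfPowX₂ hpos)
    (b := 0) (c := a₂ + a₁₂) (d := 0) (e := 0) (b' := a₄₁) (c' := 0) (d' := 2 * a₂₃) (e' := t)
    (Or.inl (by simp)) hI.bound₄₁.1 (by rw [ht] at w2; linarith)
  rcases hcl with hcl | hcl | ⟨_ | s, hcl⟩
  · omega
  · omega
  · omega
  -- By the first condition the degree does not increase with $k$, so the member found can be
  -- replaced by the one with the least admissible $k$: $0$ if $a_{13}\le a_{23}$, else $1$.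
  · have hs := Nat.mul_le_mul_left s hle
    simp only [add_mul, mul_add] at hcl hs
    omega

/-! ### Sufficiency of the three conditions -/

theorem degree_le (hpos : ∀ i, 0 < n i) (hmono : StrictMono n)
    (hI : IsGorensteinCase2a K n a₁ a₂ a₃ a₄ a₁₂ a₁₃ a₂₃ a₂₄ a₃₁ a₃₄ a₄₁ a₄₂) :
    a₁₂ + a₁₃ ≤ a₁ ∧ a₂₃ + a₂₄ ≤ a₂ ∧ a₄ ≤ a₄₁ + a₄₂ := by
  obtain ⟨w1, w2, -, w4, -⟩ := hI.weights
  have le {i j : Fin 4} (h : i ≤ j) (a : ℕ) : a * n i ≤ a * n j :=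
    Nat.mul_le_mul_left a (hmono.monotone h)
  refine ⟨Nat.le_of_mul_le_mul_right (c := n 0) ?_ (hpos 0),
    Nat.le_of_mul_le_mul_right (c := n 1) ?_ (hpos 1),
    Nat.le_of_mul_le_mul_right (c := n 3) ?_ (hpos 3)⟩
  · rw [add_mul, w1]
    exact add_le_add (le (by decide) _) (le (by decide) _)
  · rw [add_mul, w2]
    exact add_le_add (le (by decide) _) (le (by decide) _)
  · rw [add_mul, w4]
    exact add_le_add (le (by decide) _) (le (by decide) _)

/-- A monomial in `x₂, x₃, x₄` divisible by none of the six leading monomials has the weight of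
no multiple of `x₁`. -/
theorem eq_zero_of_weight_eq (hpos : ∀ i, 0 < n i)
    (hI : IsGorensteinCase2a K n a₁ a₂ a₃ a₄ a₁₂ a₁₃ a₂₃ a₂₄ a₃₁ a₃₄ a₄₁ a₄₂) {c d e : ℕ}
    (r1 : ¬(a₁₂ ≤ c ∧ a₁₃ ≤ d)) (r2 : ¬(a₂₃ ≤ d ∧ a₂₄ ≤ e)) (r3 : ¬a₃ ≤ d) (r4 : ¬a₄ ≤ e)
    (r5 : ¬(a₁₂ ≤ c ∧ a₃₄ ≤ e)) (r6 : ¬a₂ + a₁₂ ≤ c) {b' c' d' e' : ℕ}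
    (hw : 0 * n 0 + c * n 1 + d * n 2 + e * n 3 = b' * n 0 + c' * n 1 + d' * n 2 + e' * n 3) :
    b' = 0 := by
  obtain ⟨i1, i2, i3, i4⟩ := hI.exponent_identities hpos
  -- The second alternative is needed when $a_2\le c<a_2+a_{12}$: $f_2$ then applies once, and
  -- afterwards only its inverse does.
  have := hI.of_isMoveInvariant (P := fun i j k l => (i = 0 ∧ j = c ∧ k = d ∧ l = e) ∨
    (i = 0 ∧ j + a₂ = c ∧ k = d + a₂₃ ∧ l = e + a₂₄)) ?_ (Or.inl ⟨rfl, rfl, rfl, rfl⟩) hw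
  · omega
  · clear hw
    obtain ⟨p1, p2, p3, p4, p5, p6, p7, p8, -⟩ := hI
    constructor
    · intros; omega
    · intros; omega
    · intros; omega
    · intros; omega
    · intros; omega

theorem hasMultipleOfX₁_of_le (hpos : ∀ i, 0 < n i) (hmono : StrictMono n)
    (hI : IsGorensteinCase2a K n a₁ a₂ a₃ a₄ a₁₂ a₁₃ a₂₃ a₂₄ a₃₁ a₃₄ a₄₁ a₄₂) (ha : a₃₄ ≤ a₂₄)
    (hc1 : a₃ ≤ a₃₁ + a₃₄) (hc2 : a₁₂ + a₃₄ ≤ a₄₁ + a₂₃)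
    (hc3 : (a₂₃ < a₁₃ ∧ a₂ + a₁₂ ≤ a₄₁ + 2 * a₂₃ + (a₂₄ - a₃₄)) ∨
      (a₁₃ ≤ a₂₃ ∧ a₂ + a₁₂ ≤ a₁ + (a₂₃ - a₁₃) + a₂₄)) : HasMultipleOfX₁ n := by
  obtain ⟨w1, w2, w3, w4, w5⟩ := hI.weights
  obtain ⟨i1, i2, i3, i4⟩ := hI.exponent_identities hpos
  obtain ⟨p1, p2, p3, p4, p5, p6, p7, p8, -⟩ := id hI
  obtain ⟨d1, d2, d4⟩ := hI.degree_le hpos hmono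
  have of_pos : ∀ {b c d e i j k l : ℕ}, 0 < i → b * n 0 + c * n 1 + d * n 2 + e * n 3 =
      i * n 0 + j * n 1 + k * n 2 + l * n 3 → b + c + d + e ≤ i + j + k + l →
      ∃ i j k l : ℕ, b * n 0 + c * n 1 + d * n 2 + e * n 3 =
        (i + 1) * n 0 + j * n 1 + k * n 2 + l * n 3 ∧ b + c + d + e ≤ i + 1 + j + k + l := by
    intro b c d e i j k l hi h1 h2
    obtain ⟨i, rfl⟩ := Nat.exists_eq_succ_of_ne_zero hi.ne'
    exact ⟨i, j, k, l, h1, h2⟩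
  intro b c d e b' c' d' e' hw
  rcases Nat.eq_zero_or_pos b with rfl | hb
  swap
  · exact of_pos hb rfl le_rfl
  -- Only $x_3^{a_{23}}x_4^{a_{24}}\to x_2^{a_2}$ does not produce $x_1$ at once, and it lowers the
  -- exponent of $x_3$.
  induction d using Nat.strong_induction_on generalizing c e with
  | _ d ih =>
  by_cases r1 : a₁₂ ≤ c ∧ a₁₃ ≤ d
  · obtain ⟨⟨c, rfl⟩, ⟨d, rfl⟩⟩ := r1.imp Nat.exists_eq_add_of_le Nat.exists_eq_add_of_le
    exact of_pos (i := a₁) (j := c) (k := d) (l := e) (by omega) (by linarith) (by omega)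
  by_cases r2 : a₂₃ ≤ d ∧ a₂₄ ≤ e
  · obtain ⟨⟨d, rfl⟩, ⟨e, rfl⟩⟩ := r2.imp Nat.exists_eq_add_of_le Nat.exists_eq_add_of_le
    obtain ⟨i, j, k, l, h1, h2⟩ := ih d (by omega) (c + a₂) e (by linarith)
    exact ⟨i, j, k, l, by linarith, by omega⟩
  by_cases r3 : a₃ ≤ d
  · obtain ⟨d, rfl⟩ := Nat.exists_eq_add_of_le r3
    exact of_pos (i := a₃₁) (j := c) (k := d) (l := e + a₃₄) (by omega) (by linarith) (by omega)
  by_cases r4 : a₄ ≤ e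
  · obtain ⟨e, rfl⟩ := Nat.exists_eq_add_of_le r4
    exact of_pos (i := a₄₁) (j := c + a₄₂) (k := d) (l := e) (by omega) (by linarith) (by omega)
  by_cases r5 : a₁₂ ≤ c ∧ a₃₄ ≤ e
  · obtain ⟨⟨c, rfl⟩, ⟨e, rfl⟩⟩ := r5.imp Nat.exists_eq_add_of_le Nat.exists_eq_add_of_le
    exact of_pos (i := a₄₁) (j := c) (k := d + a₂₃) (l := e) (by omega) (by linarith) (by omega)
  by_cases r6 : a₂ + a₁₂ ≤ c
  · obtain ⟨c, rfl⟩ := Nat.exists_eq_add_of_le r6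
    -- $x_2^{a_2+a_{12}}$ is replaced by the member $k=1$, respectively $k=0$, of its weight class.
    rcases hc3 with ⟨h1, h2⟩ | ⟨h1, h2⟩
    · obtain ⟨t, ht⟩ := Nat.exists_eq_add_of_le ha
      exact of_pos (i := a₄₁) (j := c) (k := d + 2 * a₂₃) (l := e + t) (by omega)
        (by rw [ht] at w2; linarith) (by omega)
    · obtain ⟨t, ht⟩ := Nat.exists_eq_add_of_le h1
      exact of_pos (i := a₁) (j := c) (k := d + t) (l := e + a₂₄) (by omega)
        (by rw [ht] at w2; linarith) (by omega)
  exact absurd (hI.eq_zero_of_weight_eq hpos r1 r2 r3 r4 r5 r6 hw) (by omega)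

end IsGorensteinCase2a
theorem mainTheorem4 {K : Type*} [Field K] (n : Fin 4 → ℕ)
    (hpos : ∀ i, 0 < n i) (hmono : StrictMono n) (hgcd : Finset.univ.gcd n = 1)
    (a₁ a₂ a₃ a₄ a₁₂ a₁₃ a₂₃ a₂₄ a₃₁ a₃₄ a₄₁ a₄₂ : ℕ)
    (hI : IsGorensteinCase2a K n a₁ a₂ a₃ a₄ a₁₂ a₁₃ a₂₃ a₂₄ a₃₁ a₃₄ a₄₁ a₄₂)
    (h : a₃₄ ≤ a₂₄) :
    IsCohenMacaulayRing (TangentCone K n) ↔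
      a₃ ≤ a₃₁ + a₃₄ ∧
      a₁₂ + a₃₄ ≤ a₄₁ + a₂₃ ∧
      ((a₂₃ < a₁₃ ∧ a₂ + a₁₂ ≤ a₄₁ + 2 * a₂₃ + (a₂₄ - a₃₄)) ∨
        (a₁₃ ≤ a₂₃ ∧ a₂ + a₁₂ ≤ a₁ + (a₂₃ - a₁₃) + a₂₄)) := by
  rw [IsGorensteinCase2a.isCohenMacaulayRing_iff_hasMultipleOfX₁ hpos hmono]
  exact ⟨fun hm => ⟨hI.le_of_hasMultipleOfX₁ hm, hI.add_le_of_hasMultipleOfX₁ hm,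
    hI.add_le_cases_of_hasMultipleOfX₁ hpos hm h⟩,
    fun hc => hI.hasMultipleOfX₁_of_le hpos hmono h hc.1 hc.2.1 hc.2.2⟩
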